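/- Let $\mathcal{D}=\{s\in\mathbb{C}: 1/2<\operatorname{Re}(s)<1\}$ and let $\zeta$ be the Riemann zeta-function. Call $(K,f,\varepsilon)^*$ admissible if $K\subseteq\mathcal{D}$ is a compact set with connected complement in $\mathbb{C}$, $f:K\to\mathbb{C}$ is continuous and non-vanishing on $K$ and analytic in the interior of $K$, and $\varepsilon>0$. Suppose that $\zeta$ is continuously universal, i.e. that for every admissible $(K,f,\varepsilon)^*$ $$\liminf_{T\to\infty}\frac1T\,\mathrm{meas}\Big\{\tau\in[0,T]:\max_{s\in K}|\zeta(s+i\tau)-f(s)|<\varepsilon\Big\}>0,$$ where $\mathrm{meas}$ denotes Lebesgue measure. Then there is a dense $G_\delta$-set $J\subseteq\mathbb{R}_+=[0,\infty)$ such that for every $t_0\in J$ and every admissible $(K,f,\varepsilon)^*$ there is a strictly increasing sequence $(n_k)_{k\ge1}$ of non-negative integers such that $$\max_{s\in K}|\zeta(s+it_0n_k)-f(s)|<\varepsilon\qquad\text{for all }k\ge1.$$ (No unproved hypothesis such as the Riemann hypothesis is assumed.) -/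

import Mathlib

/-- The open strip of all complex numbers with real part strictly between 1/2 and 1. -/
def universalityStrip : Set ℂ := {s : ℂ | 1 / 2 < s.re ∧ s.re < 1}

/-- The triple `(K, f, ε)` is admissible and `f` has no zeros on `K`.
Only the values of `f` on `K` matter. -/
structure AdmissibleNonvanishing (K : Set ℂ) (f : ℂ → ℂ) (ε : ℝ) : Prop where
  subset_strip : K ⊆ universalityStrip
  isCompact : IsCompact K
  connected_compl : IsConnected Kᶜ
  continuousOn : ContinuousOn f K
  analytic_interior : AnalyticOnNhd ℂ f (interior K)
  ne_zero : ∀ s ∈ K, f s ≠ 0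
  eps_pos : 0 < ε

/-- The vertical shift of the Riemann zeta-function by `τ` is uniformly `ε`-close to `f` on `K`
(for compact `K` and continuous functions: the maximum of the difference over `K` is `< ε`). -/
def ZetaShiftApprox (K : Set ℂ) (f : ℂ → ℂ) (ε τ : ℝ) : Prop :=
  ∀ s ∈ K, ‖riemannZeta (s + Complex.I * (τ : ℂ)) - f s‖ < ε

/-- The lower density of `A ∩ [0, ∞)` with respect to Lebesgue measure, as an extended
nonnegative real: the lower limit of `meas (A ∩ [0, T]) / T` as `T → ∞`. -/
noncomputable def lowerDensity (A : Set ℝ) : ENNReal :=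
  Filter.liminf
    (fun T : ℝ => MeasureTheory.volume (A ∩ Set.Icc 0 T) / ENNReal.ofReal T) Filter.atTop

/-- Continuous universality of the Riemann zeta-function. -/
def ZetaContinuouslyUniversal : Prop :=
  ∀ (K : Set ℂ) (f : ℂ → ℂ) (ε : ℝ), AdmissibleNonvanishing K f ε →
    0 < lowerDensity {τ : ℝ | ZetaShiftApprox K f ε τ}

/-!
The universality hypothesis does two jobs. First, it reduces the uncountably many targets to
countably many: a non-vanishing `f` on `K` is itself approximated on `K` by some shift
`ζ(· + i q)`, and `q` can be taken rational since the set of good shifts is open. This shift is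
holomorphic and zero-free on a neighbourhood of `K` in the strip, so `K` may be replaced by a
larger compact set from a fixed countable family of compact sets with connected complement
(`exists_countable_compact_connected_compl`). No polynomial approximation is needed.

Secondly, for each of the resulting countably many triples the set `A` of good shifts is open
(`isOpen_setOf_zetaShiftApprox`) and, having positive lower density, unbounded above
(`not_bddAbove_of_lowerDensity_pos`). For such an `A` and any `N`, the set of `t > 0` with
`t * n ∈ A` for some `n ≥ N` is open and dense, because the dilates `n • (a, b)` of an interval
with `0 < a < b` eventually overlap and cover a half-line (`exists_mul_natCast_mem`). Baire's
theorem then yields the dense `Gδ` set (`exists_isGδ_frequently_mul_natCast_mem`).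

The countable family of compact sets rests on `exists_compact_nhds_connected_compl`: thicken `K`
slightly and fill in the bounded components of the complement. The filled set stays close to `K`
because, as the thickening shrinks, the unbounded components exhaust the connected set `Kᶜ`.
-/

open Set Filter Topology

/-! ### Compact plane sets with connected complement -/

/-- This set is the image of a half-plane under the exponential map. -/
lemma isPreconnected_setOf_lt_norm {R : ℝ} (hR : 0 < R) : IsPreconnected {z : ℂ | R < ‖z‖} := by
  have h : {z : ℂ | R < ‖z‖} = Complex.exp '' {w : ℂ | Real.log R < w.re} := by
    ext z
    simp only [mem_ofPred_eq, mem_image]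
    constructor
    · intro hz
      have hz0 : z ≠ 0 := norm_pos_iff.1 (hR.trans hz)
      exact ⟨Complex.log z, by rw [Complex.log_re]; exact Real.log_lt_log hR hz,
        Complex.exp_log hz0⟩
    · rintro ⟨w, hw, rfl⟩
      rw [Complex.norm_exp]
      exact (Real.log_lt_iff_lt_exp hR).1 hw
  rw [h]
  exact (convex_halfSpace_re_gt _).isPreconnected.image _ Complex.continuous_exp.continuousOn

/-- A compact plane set with connected complement has arbitrarily small compact neighbourhoods
with connected complement. -/
lemma exists_compact_nhds_connected_compl {K U : Set ℂ} (hK : IsCompact K) (hKc : IsConnected Kᶜ)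
    (hU : IsOpen U) (hKU : K ⊆ U) :
    ∃ L : Set ℂ, IsCompact L ∧ IsConnected Lᶜ ∧ K ⊆ interior L ∧ L ⊆ U := by
  obtain ⟨R, hR0, hR⟩ : ∃ R : ℝ, 0 < R ∧ Metric.cthickening 1 K ⊆ Metric.closedBall 0 R :=
    hK.isBounded.cthickening.subset_closedBall_lt 0 0
  set δ : ℕ → ℝ := fun n => 1 / ((n : ℝ) + 1) with hδ
  have hδ0 (n : ℕ) : 0 < δ n := Nat.one_div_pos_of_nat
  have hδ1 (n : ℕ) : δ n ≤ 1 := by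
    rw [hδ]; simp only
    rw [div_le_one (by positivity)]
    linarith [(Nat.cast_nonneg n : (0 : ℝ) ≤ n)]
  have hfar (n : ℕ) : {z : ℂ | R < ‖z‖} ⊆ (Metric.cthickening (δ n) K)ᶜ := by
    intro z hz hzK
    have := hR (Metric.cthickening_mono (hδ1 n) K hzK)
    rw [mem_closedBall_zero_iff] at this
    exact absurd hz (not_lt.2 this)
  obtain ⟨p, hp⟩ : ∃ p : ℂ, R < ‖p‖ := NormedSpace.exists_lt_norm ℂ ℂ R
  -- `C n` is the unbounded component of the complement of the closed `δ n`-thickening of `K`.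
  set C : ℕ → Set ℂ := fun n => connectedComponentIn (Metric.cthickening (δ n) K)ᶜ p with hC
  have hCfar (n : ℕ) : {z : ℂ | R < ‖z‖} ⊆ C n :=
    (isPreconnected_setOf_lt_norm hR0).subset_connectedComponentIn hp (hfar n)
  have hCopen (n : ℕ) : IsOpen (C n) :=
    Metric.isClosed_cthickening.isOpen_compl.connectedComponentIn
  have hCmono : Monotone C := fun m n hmn =>
    connectedComponentIn_mono p (compl_subset_compl.2
      (Metric.cthickening_mono (Nat.one_div_le_one_div hmn) K))
  have hpK : p ∈ Kᶜ := fun h => hfar 0 hp (Metric.self_subset_cthickening K h)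
  have hcover : Kᶜ ⊆ ⋃ n, C n := by
    intro z hz
    have hpath := hK.isClosed.isOpen_compl.isConnected_iff_isPathConnected.1 hKc
    obtain ⟨γ, hγ⟩ := hpath.joinedIn p hpK z hz
    have hdisj : Disjoint K (range γ) :=
      disjoint_left.2 fun x hx ⟨t, ht⟩ => hγ t (ht ▸ hx)
    obtain ⟨η, hη, hd⟩ := hdisj.exists_cthickenings hK (isCompact_range γ.continuous).isClosed
    obtain ⟨n, hn⟩ := exists_nat_one_div_lt hη
    refine mem_iUnion.2 ⟨n, ?_⟩
    have hsub : range γ ⊆ (Metric.cthickening (δ n) K)ᶜ := fun x hx hxK =>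
      disjoint_left.1 hd (Metric.cthickening_mono hn.le K hxK)
        (Metric.self_subset_cthickening _ hx)
    exact (isPreconnected_range γ.continuous).subset_connectedComponentIn ⟨0, γ.source⟩ hsub
      ⟨1, γ.target⟩
  obtain ⟨n, hn⟩ := ((isCompact_closedBall (0 : ℂ) R).diff hU).elim_directed_cover C hCopen
    (fun z hz => hcover fun hzK => hz.2 (hKU hzK)) hCmono.directed_le
  refine ⟨(C n)ᶜ, ?_, ?_, ?_, ?_⟩
  · refine (isCompact_closedBall (0 : ℂ) R).of_isClosed_subset (hCopen n).isClosed_compl ?_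
    intro z hz
    rw [mem_closedBall_zero_iff]
    exact not_lt.1 fun h => hz (hCfar n h)
  · rw [compl_compl]
    exact isConnected_connectedComponentIn_iff.2 (hfar n hp)
  · calc K ⊆ Metric.thickening (δ n) K := Metric.self_subset_thickening (hδ0 n) K
      _ ⊆ interior (C n)ᶜ := interior_maximal
          ((Metric.thickening_subset_cthickening _ _).trans
            (subset_compl_comm.1 (connectedComponentIn_subset _ _))) Metric.isOpen_thickening
  · intro z hz
    by_contra hzU
    refine hz ?_
    by_cases hzR : R < ‖z‖
    · exact hCfar n hzR
    · exact hn ⟨mem_closedBall_zero_iff.2 (not_lt.1 hzR), hzU⟩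

/-- In a second countable space, countably many sets suffice to separate compact sets from the
complements of their open neighbourhoods. -/
lemma exists_countable_between (X : Type*) [TopologicalSpace X] [SecondCountableTopology X] :
    ∃ 𝒲 : Set (Set X), 𝒲.Countable ∧
      ∀ K U : Set X, IsCompact K → IsOpen U → K ⊆ U → ∃ W ∈ 𝒲, K ⊆ W ∧ W ⊆ U := by
  refine ⟨sUnion '' {F | F.Finite ∧ F ⊆ TopologicalSpace.countableBasis X},
    (countable_ofPred_finite_subset (TopologicalSpace.countable_countableBasis X)).image _, ?_⟩
  intro K U hK hU hKU
  have hb := TopologicalSpace.isBasis_countableBasis X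
  obtain ⟨F, hFsub, hFfin, hF⟩ := hK.elim_finite_subcover_image
    (b := {V | V ∈ TopologicalSpace.countableBasis X ∧ V ⊆ U}) (c := id)
    (fun V hV => hb.isOpen hV.1) (fun x hx => by
      obtain ⟨V, hV, hxV, hVU⟩ := hb.exists_subset_of_mem_open (hKU hx) hU
      exact mem_biUnion (show V ∈ {V | _ ∧ _} from ⟨hV, hVU⟩) hxV)
  refine ⟨⋃₀ F, ⟨F, ⟨hFfin, fun V hV => (hFsub hV).1⟩, rfl⟩, ?_,
    sUnion_subset fun V hV => (hFsub hV).2⟩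
  rwa [sUnion_eq_biUnion]

lemma exists_countable_compact_connected_compl :
    ∃ 𝓛 : Set (Set ℂ), 𝓛.Countable ∧ (∀ L ∈ 𝓛, IsCompact L ∧ IsConnected Lᶜ) ∧
      ∀ K U : Set ℂ, IsCompact K → IsConnected Kᶜ → IsOpen U → K ⊆ U →
        ∃ L ∈ 𝓛, K ⊆ L ∧ L ⊆ U := by
  obtain ⟨𝒲, h𝒲, hbetween⟩ := exists_countable_between ℂ
  -- For every pair `W, V` in `𝒲` choose one good compact set between `W` and `V`, if any.
  set S : Set (Set ℂ × Set ℂ) := {p ∈ 𝒲 ×ˢ 𝒲 |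
    ∃ L, (IsCompact L ∧ IsConnected Lᶜ) ∧ p.1 ⊆ L ∧ L ⊆ p.2} with hS
  have hScount : S.Countable := (h𝒲.prod h𝒲).mono (sep_subset _ _)
  have : Countable S := hScount.to_subtype
  choose L hL hWL hLV using fun p : S => p.2.2
  refine ⟨range L, countable_range L, forall_mem_range.2 hL, ?_⟩
  intro K U hK hKc hU hKU
  obtain ⟨L₀, hL₀, hL₀c, hKL₀, hL₀U⟩ := exists_compact_nhds_connected_compl hK hKc hU hKU
  obtain ⟨W, hW, hKW, hWL₀⟩ := hbetween K (interior L₀) hK isOpen_interior hKL₀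
  obtain ⟨V, hV, hL₀V, hVU⟩ := hbetween L₀ U hL₀ hU hL₀U
  let p : S := ⟨(W, V), ⟨hW, hV⟩, L₀, ⟨hL₀, hL₀c⟩, hWL₀.trans interior_subset, hL₀V⟩
  exact ⟨L p, mem_range_self p, hKW.trans (hWL p), (hLV p).trans hVU⟩

/-! ### Multiples hitting unbounded open sets -/

lemma exists_mul_natCast_mem {A : Set ℝ} (hA : ¬ BddAbove A) {a b : ℝ} (ha : 0 < a) (hab : a < b)
    (N : ℕ) : ∃ t ∈ Ioo a b, ∃ n ≥ N, t * (n : ℝ) ∈ A := by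
  have hb : 0 < b := ha.trans hab
  -- For `τ > a * b / (b - a)` the interval `(τ / b, τ / a)` has length greater than `1`.
  obtain ⟨τ, hτA, hτ⟩ := not_bddAbove_iff.1 hA (max (a * b / (b - a)) (N * b))
  obtain ⟨h1, h2⟩ := max_lt_iff.1 hτ
  have hτ0 : 0 < τ := lt_of_le_of_lt (by positivity) h2
  set n := ⌊τ / b⌋₊ + 1 with hn
  have hlt : τ / b < n := by rw [hn]; exact_mod_cast Nat.lt_floor_add_one (τ / b)
  have hle : (n : ℝ) ≤ τ / b + 1 := by
    rw [hn]; push_cast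
    linarith [Nat.floor_le (div_pos hτ0 hb).le]
  have hn0 : (0 : ℝ) < n := (div_pos hτ0 hb).trans hlt
  refine ⟨τ / n, ⟨?_, ?_⟩, n, ?_, ?_⟩
  · rw [lt_div_iff₀ hn0]
    rw [div_lt_iff₀ (sub_pos.2 hab)] at h1
    have h3 : a * n ≤ a * (τ / b + 1) := mul_le_mul_of_nonneg_left hle ha.le
    have h4 : a * (τ / b + 1) < τ := by
      rw [← sub_pos]
      have : τ - a * (τ / b + 1) = (τ * (b - a) - a * b) / b := by field_simp; ring
      rw [this]
      exact div_pos (sub_pos.2 h1) hb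
    exact h3.trans_lt h4
  · rwa [div_lt_comm₀ hn0 hb]
  · have : (N : ℝ) < n := ((lt_div_iff₀ hb).2 h2).trans hlt
    exact_mod_cast this.le
  · rwa [div_mul_cancel₀ _ hn0.ne']

lemma exists_isGδ_frequently_mul_natCast_mem {ι : Type*} [Countable ι] {A : ι → Set ℝ}
    (hopen : ∀ i, IsOpen (A i)) (hunbdd : ∀ i, ¬ BddAbove (A i)) :
    ∃ J : Set ℝ, J ⊆ Ici 0 ∧ IsGδ J ∧ Ici 0 ⊆ closure J ∧
      ∀ t ∈ J, ∀ i, ∃ᶠ n : ℕ in atTop, t * (n : ℝ) ∈ A i := by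
  set G : ι × ℕ → Set ℝ := fun p => {t | ∃ n ≥ p.2, t * (n : ℝ) ∈ A p.1} with hG
  have hGopen (p : ι × ℕ) : IsOpen (G p) := by
    have : G p = ⋃ n ≥ p.2, (fun t : ℝ => t * (n : ℝ)) ⁻¹' A p.1 := by
      ext t; simp [hG]
    rw [this]
    exact isOpen_biUnion fun n _ => (hopen p.1).preimage (by fun_prop)
  -- Adding the negative half-line makes the sets dense in all of `ℝ`.
  have hdense (p : ι × ℕ) : Dense (G p ∪ Iio 0) := by
    refine dense_of_exists_between fun x y hxy => ?_
    by_cases hx : x < 0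
    · obtain ⟨z, hxz, hz⟩ := exists_between (lt_min hx hxy)
      exact ⟨z, Or.inr (hz.trans_le (min_le_left _ _)), hxz, hz.trans_le (min_le_right _ _)⟩
    · obtain ⟨x', hx', hx'y⟩ := exists_between hxy
      obtain ⟨t, ht, n, hn, hnA⟩ :=
        exists_mul_natCast_mem (hunbdd p.1) ((not_lt.1 hx).trans_lt hx') hx'y p.2
      exact ⟨t, Or.inl ⟨n, hn, hnA⟩, hx'.trans ht.1, ht.2⟩
  have hopen' (p : ι × ℕ) : IsOpen (G p ∪ Iio 0) := (hGopen p).union isOpen_Iio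
  refine ⟨Ioi 0 ∩ ⋂ p, (G p ∪ Iio 0), inter_subset_left.trans Ioi_subset_Ici_self,
    isOpen_Ioi.isGδ.inter (.iInter fun p => (hopen' p).isGδ), ?_, ?_⟩
  · rw [← closure_Ioi]
    exact closure_minimal
      ((dense_iInter_of_isOpen hopen' hdense).open_subset_closure_inter isOpen_Ioi) isClosed_closure
  · rintro t ⟨ht0, ht⟩ i
    refine frequently_atTop.2 fun N => ?_
    exact (mem_iInter.1 ht (i, N)).resolve_right (not_lt.2 (mem_Ioi.1 ht0).le)

/-! ### The set of good shifts -/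

lemma not_bddAbove_of_lowerDensity_pos {A : Set ℝ} (hA : 0 < lowerDensity A) : ¬ BddAbove A := by
  rintro ⟨M, hM⟩
  refine hA.ne' ?_
  have hbound (T : ℝ) : MeasureTheory.volume (A ∩ Icc 0 T) / ENNReal.ofReal T ≤
      ENNReal.ofReal M / ENNReal.ofReal T := by
    gcongr
    calc MeasureTheory.volume (A ∩ Icc 0 T) ≤ MeasureTheory.volume (Icc 0 M) :=
          MeasureTheory.measure_mono fun x hx => ⟨hx.2.1, hM hx.1⟩
      _ = ENNReal.ofReal M := by simp
  have hlim : Tendsto (fun T : ℝ => ENNReal.ofReal M / ENNReal.ofReal T) atTop (𝓝 0) := by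
    have := ENNReal.Tendsto.const_div (a := ENNReal.ofReal M) ENNReal.tendsto_ofReal_atTop
      (Or.inr ENNReal.ofReal_ne_top)
    simpa using this
  exact (tendsto_of_tendsto_of_tendsto_of_le_of_le tendsto_const_nhds hlim
    (fun _ => zero_le) hbound).liminf_eq

lemma isOpen_universalityStrip : IsOpen universalityStrip :=
  (isOpen_lt continuous_const Complex.continuous_re).inter
    (isOpen_lt Complex.continuous_re continuous_const)

lemma add_I_mul_ne_one {s : ℂ} (hs : s ∈ universalityStrip) (τ : ℝ) :
    s + Complex.I * (τ : ℂ) ≠ 1 := by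
  intro h
  have := congrArg Complex.re h
  simp at this
  exact hs.2.ne this

lemma differentiableOn_riemannZeta_shift (τ : ℝ) :
    DifferentiableOn ℂ (fun s => riemannZeta (s + Complex.I * (τ : ℂ))) universalityStrip :=
  fun s hs => ((differentiableAt_riemannZeta (add_I_mul_ne_one hs τ)).comp s
    (differentiableAt_id.add_const _)).differentiableWithinAt

lemma isOpen_setOf_zetaShiftApprox {K : Set ℂ} {f : ℂ → ℂ} {ε : ℝ}
    (hK : IsCompact K) (hKD : K ⊆ universalityStrip) (hf : ContinuousOn f K) :
    IsOpen {τ : ℝ | ZetaShiftApprox K f ε τ} := by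
  have : CompactSpace K := isCompact_iff_compactSpace.1 hK
  have hcont : Continuous fun p : ℝ × K =>
      ‖riemannZeta ((p.2 : ℂ) + Complex.I * (p.1 : ℂ)) - f p.2‖ := by
    refine (Continuous.sub ?_ (hf.domRestrict.comp continuous_snd)).norm
    refine continuous_iff_continuousAt.2 fun p => ?_
    exact ContinuousAt.comp
      (f := fun p : ℝ × K => (p.2 : ℂ) + Complex.I * (p.1 : ℂ))
      (differentiableAt_riemannZeta (add_I_mul_ne_one (hKD p.2.2) p.1)).continuousAt
      (by fun_prop)
  rw [isOpen_iff_mem_nhds]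
  intro τ hτ
  have h := isCompact_univ.eventually_forall_of_forall_eventually (x₀ := τ)
    (K := (univ : Set K))
    (P := fun t (s : K) => ‖riemannZeta ((s : ℂ) + Complex.I * (t : ℂ)) - f s‖ < ε)
    fun s _ => hcont.continuousAt.eventually_lt continuousAt_const (hτ s s.2)
  filter_upwards [h] with t ht s hs
  exact ht ⟨s, hs⟩ (mem_univ _)

lemma admissibleNonvanishing_riemannZeta_shift {L : Set ℂ} {ε τ : ℝ} (hL : IsCompact L)
    (hLc : IsConnected Lᶜ) (hε : 0 < ε)
    (hLU : L ⊆ universalityStrip ∩ {s | riemannZeta (s + Complex.I * (τ : ℂ)) ≠ 0}) :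
    AdmissibleNonvanishing L (fun s => riemannZeta (s + Complex.I * (τ : ℂ))) ε where
  subset_strip := hLU.trans inter_subset_left
  isCompact := hL
  connected_compl := hLc
  continuousOn :=
    (differentiableOn_riemannZeta_shift τ).continuousOn.mono (hLU.trans inter_subset_left)
  analytic_interior := ((differentiableOn_riemannZeta_shift τ).analyticOnNhd
    isOpen_universalityStrip).mono (interior_subset.trans (hLU.trans inter_subset_left))
  ne_zero := fun _ hs => (hLU hs).2
  eps_pos := hε

/-- Under universality, the target function may be replaced by a rational shift of `ζ`; approximating
more closely than the minimum of `‖f‖` on `K` keeps this shift free of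
zeros on `K`. -/
lemma exists_rat_zetaShiftApprox (hζ : ZetaContinuouslyUniversal) {K : Set ℂ} {f : ℂ → ℂ} {ε : ℝ}
    (h : AdmissibleNonvanishing K f ε) :
    ∃ q : ℚ, ZetaShiftApprox K f ε q ∧
      ∀ s ∈ K, riemannZeta (s + Complex.I * ((q : ℝ) : ℂ)) ≠ 0 := by
  obtain ⟨m, hm, hmf⟩ : ∃ m : ℝ, 0 < m ∧ ∀ s ∈ K, m ≤ ‖f s‖ :=
    h.isCompact.exists_forall_le' h.continuousOn.norm fun s hs => norm_pos_iff.2 (h.ne_zero s hs)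
  have h' : AdmissibleNonvanishing K f (min ε m) :=
    { h with eps_pos := lt_min h.eps_pos hm }
  have hne : {τ : ℝ | ZetaShiftApprox K f (min ε m) τ}.Nonempty := by
    refine nonempty_iff_ne_empty.2 fun he => ?_
    exact not_bddAbove_of_lowerDensity_pos (hζ K f _ h') (he ▸ bddAbove_empty)
  obtain ⟨_, hq, q, rfl⟩ := (Rat.denseRange_cast (𝕜 := ℝ)).inter_open_nonempty _
    (isOpen_setOf_zetaShiftApprox h.isCompact h.subset_strip h.continuousOn) hne
  refine ⟨q, fun s hs => (hq s hs).trans_le (min_le_left _ _), fun s hs h0 => ?_⟩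
  have := (hq s hs).trans_le (min_le_right _ _)
  rw [h0, zero_sub, norm_neg] at this
  exact (hmf s hs).not_gt this

/-! ### Generic step sizes -/

theorem theorem3 (hζ : ZetaContinuouslyUniversal) :
    ∃ J : Set ℝ, J ⊆ Set.Ici 0 ∧ IsGδ J ∧ Set.Ici 0 ⊆ closure J ∧
      ∀ t₀ ∈ J, ∀ (K : Set ℂ) (f : ℂ → ℂ) (ε : ℝ), AdmissibleNonvanishing K f ε →
        ∃ n : ℕ → ℕ, StrictMono n ∧ ∀ k : ℕ, ZetaShiftApprox K f ε (t₀ * (n k : ℝ)) := by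
  obtain ⟨𝓛, h𝓛, h𝓛good, h𝓛sub⟩ := exists_countable_compact_connected_compl
  set S : Set (Set ℂ × ℚ × ℕ) := {p | p.1 ∈ 𝓛 ∧ AdmissibleNonvanishing p.1
    (fun s => riemannZeta (s + Complex.I * ((p.2.1 : ℝ) : ℂ))) (1 / ((p.2.2 : ℝ) + 1))} with hS
  have : Countable S :=
    ((h𝓛.prod (countable_univ (α := ℚ × ℕ))).mono fun (p : Set ℂ × ℚ × ℕ) (hp : p ∈ S) =>
      Set.mk_mem_prod hp.1 (mem_univ _)).to_subtype
  obtain ⟨J, hJ0, hJG, hJd, hJ⟩ := exists_isGδ_frequently_mul_natCast_mem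
    (A := fun p : S => {τ : ℝ | ZetaShiftApprox p.1.1
      (fun s => riemannZeta (s + Complex.I * ((p.1.2.1 : ℝ) : ℂ))) (1 / ((p.1.2.2 : ℝ) + 1)) τ})
    (fun p => isOpen_setOf_zetaShiftApprox p.2.2.isCompact p.2.2.subset_strip p.2.2.continuousOn)
    (fun p => not_bddAbove_of_lowerDensity_pos (hζ _ _ _ p.2.2))
  refine ⟨J, hJ0, hJG, hJd, fun t ht K f ε h => ?_⟩
  obtain ⟨q, hqf, hq0⟩ := exists_rat_zetaShiftApprox hζ
    (show AdmissibleNonvanishing K f (ε / 2) from { h with eps_pos := half_pos h.eps_pos })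
  obtain ⟨j, hj⟩ := exists_nat_one_div_lt (half_pos h.eps_pos)
  obtain ⟨L, hL, hKL, hLU⟩ := h𝓛sub K
    (universalityStrip ∩ {s | riemannZeta (s + Complex.I * ((q : ℝ) : ℂ)) ≠ 0})
    h.isCompact h.connected_compl
    ((differentiableOn_riemannZeta_shift q).continuousOn.isOpen_inter_preimage
      isOpen_universalityStrip isOpen_ne)
    fun s hs => ⟨h.subset_strip hs, hq0 s hs⟩
  have hp : (L, q, j) ∈ S := ⟨hL, admissibleNonvanishing_riemannZeta_shift
    (h𝓛good L hL).1 (h𝓛good L hL).2 Nat.one_div_pos_of_nat hLU⟩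
  obtain ⟨n, hn, hnA⟩ := extraction_of_frequently_atTop (hJ t ht ⟨_, hp⟩)
  refine ⟨n, hn, fun k s hs => ?_⟩
  have h1 := hnA k s (hKL hs)
  have h2 := hqf s hs
  simp only at h1
  calc ‖riemannZeta (s + Complex.I * ((t * (n k : ℝ) : ℝ) : ℂ)) - f s‖
      ≤ _ + _ := norm_sub_le_norm_sub_add_norm_sub _
        (riemannZeta (s + Complex.I * ((q : ℝ) : ℂ))) _
    _ < ε / 2 + ε / 2 := add_lt_add (h1.trans hj) h2
    _ = ε := add_halves ε
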